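/- Misère Connect $k$ is played on a board of width $w\ge 1$ and height $h\ge 1$ (both finite). Players P1 and P2 alternate, P1 first; the player to move chooses a column holding fewer than $h$ pieces and drops a piece of their own into it, which lands in the lowest empty cell of that column. The game ends as soon as a player has $k$ of their own pieces in a contiguous horizontal, vertical or diagonal line, and that player loses; if the board fills up without this happening, the game is drawn. We say that the game is a \emph{P2 win} if P2 has a strategy that guarantees that P1 loses, and a \emph{draw} if each player has a strategy that guarantees that they do not lose. \textbf{Theorem.} Let $k=2$. If $h=1$, then the game is a draw for $w\in\{1,2,4,6\}$ and a P2 win for every other width $w\ge 1$ (that is, for every odd $w\ge 3$ and every even $w\ge 8$). If $h>1$, then the game is a draw for $w=1$ and a P2 win for every $w>1$. -/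

import Mathlib

namespace MisereConnect

/-- The two players; `one` moves first. -/
inductive Player
  | one
  | two
  deriving DecidableEq

/-- The other player. -/
def Player.opponent : Player → Player
  | .one => .two
  | .two => .one

/-- A position on a board with `w` columns: the pieces of each column, listed from bottom to top,
and the player to move. -/
@[ext]
structure Position (w : ℕ) where
  columns : Fin w → List Player
  turn : Player

namespace Position

variable {w : ℕ}

/-- The starting position: an empty board with player one to move. -/
def initial (w : ℕ) : Position w where
  columns := fun _ => []
  turn := .one

/-- A column may be played if it holds fewer than `h` pieces. -/
def Legal (h : ℕ) (P : Position w) (c : Fin w) : Prop :=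
  (P.columns c).length < h

/-- The player to move drops a piece into column `c`, where it lands on top of the pieces
already there. -/
def play (P : Position w) (c : Fin w) : Position w where
  columns := Function.update P.columns c (P.columns c ++ [P.turn])
  turn := P.turn.opponent

/-- Player `q` has a piece in column `x` and row `y`, both counted from `0`. Coordinates off the
board are occupied by nobody. -/
def Occupies (P : Position w) (q : Player) (x y : ℤ) : Prop :=
  ∃ (c : Fin w) (r : ℕ), ((c : ℕ) : ℤ) = x ∧ (r : ℤ) = y ∧ (P.columns c)[r]? = some q

/-- The directions of a line on the board: horizontal, vertical and the two diagonals. -/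
def directions : Finset (ℤ × ℤ) := {(1, 0), (0, 1), (1, 1), (1, -1)}

/-- Player `q` has `k` pieces in a contiguous horizontal, vertical or diagonal line. -/
def Connected (k : ℕ) (P : Position w) (q : Player) : Prop :=
  ∃ x y : ℤ, ∃ d ∈ directions, ∀ i : ℕ, i < k → P.Occupies q (x + i * d.1) (y + i * d.2)

/-- The game is over once a player has connected `k`, or when every column is full. -/
def Over (k h : ℕ) (P : Position w) : Prop :=
  (∃ q : Player, P.Connected k q) ∨ ∀ c : Fin w, ¬ P.Legal h c

end Position

/-- A strategy names a column in every position. -/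
abbrev Strategy (w : ℕ) := Position w → Fin w

/-- The positions that can arise when player `p` follows the strategy `s` and the opponent plays
arbitrary legal moves; no move is made once the game is over. -/
inductive Reachable {w : ℕ} (k h : ℕ) (p : Player) (s : Strategy w) : Position w → Prop
  | start : Reachable k h p s (Position.initial w)
  | own (P : Position w) : Reachable k h p s P → ¬ P.Over k h → P.turn = p →
      P.Legal h (s P) → Reachable k h p s (P.play (s P))
  | other (P : Position w) (c : Fin w) : Reachable k h p s P → ¬ P.Over k h → P.turn ≠ p →
      P.Legal h c → Reachable k h p s (P.play c)

/-- The strategy `s` of player `p` always supplies a legal move when `p` has to move, and every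
game in which `p` follows it ends in a position with property `A`. (A game has at most `w * h`
moves, so each of them ends.) -/
def Ensures {w : ℕ} (k h : ℕ) (p : Player) (s : Strategy w) (A : Position w → Prop) : Prop :=
  ∀ P : Position w, Reachable k h p s P →
    (¬ P.Over k h → P.turn = p → P.Legal h (s P)) ∧ (P.Over k h → A P)

/-- Player `p` wins under optimal play: some strategy of `p` ensures that the opponent is the one
who connects `k`. -/
def WinFor (k w h : ℕ) (p : Player) : Prop :=
  ∃ s : Strategy w, Ensures k h p s fun P => P.Connected k p.opponent

/-- The game is a draw under optimal play: each player has a strategy that ensures that he does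
not lose, that is, that he does not connect `k`. -/
def IsDraw (k w h : ℕ) : Prop :=
  ∀ p : Player, ∃ s : Strategy w, Ensures k h p s fun P => ¬ P.Connected k p

end MisereConnect

/-! Two pieces are connected exactly when they are a king's move apart, so a board with at least two
rows and two columns cannot be filled without a connection. To win, player two needs a safe reply to
every safe move of player one, and a reason why the game cannot be drawn.

For even height the reply goes on top of the piece just played. Player two's pieces are then player
one's shifted up by one, so any connection of player two would copy an earlier one of player one.

For odd height everything is decided in the bottom row. The reply there is directly to the right,
with a spare move kept for the last cell (`SafeRow`). A piece of player two away from the ends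
touches one of player one, so player one loses by climbing onto it; a safe climb at an end is
answered on top (`RowInvariant`). A draw is excluded by the full-board argument if `1 < h`, and by
counting pieces if `h = 1` and `w` is odd.

For `h = 1` and `w` even, a row filled without a connection alternates. Within two replies player
two creates pieces of opposite owners at even distance (`Clashing`) and still keeps safe replies;
there is room for this when `8 ≤ w`. For `w = 2, 4, 6` player one's draw is found by search
(`Holds`), and a single column alternates by force. -/

namespace MisereConnect

/-! ### Strategies from invariants -/

/-- An invariant that a player can maintain gives that player a strategy. -/
theorem exists_ensures {w k h : ℕ} {p : Player} [NeZero w] (I A : Position w → Prop)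
    (start : I (Position.initial w))
    (own : ∀ P, I P → ¬ P.Over k h → P.turn = p → ∃ c, P.Legal h c ∧ I (P.play c))
    (other : ∀ P c, I P → ¬ P.Over k h → P.turn ≠ p → P.Legal h c → I (P.play c))
    (final : ∀ P, I P → P.Over k h → A P) :
    ∃ s : Strategy w, Ensures k h p s A := by
  classical
  -- The default column `0` is never used where `I` holds, the game is not over and `p` is to move.
  let s : Strategy w := fun P =>
    if hP : ∃ c, P.Legal h c ∧ I (P.play c) then hP.choose else 0
  have hs : ∀ P, I P → ¬ P.Over k h → P.turn = p → P.Legal h (s P) ∧ I (P.play (s P)) := by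
    intro P hI hO ht
    have hP := own P hI hO ht
    simp only [s, dif_pos hP]
    exact hP.choose_spec
  refine ⟨s, fun P hR => ?_⟩
  have hI : I P := by
    induction hR with
    | start => exact start
    | own P _ hO ht _ ih => exact (hs P ih hO ht).2
    | other P c _ hO ht hl ih => exact other P c ih hO ht hl
  exact ⟨fun hO ht => (hs P hI hO ht).1, final P hI⟩

theorem Ensures.mono {w k h : ℕ} {p : Player} {s : Strategy w} {A B : Position w → Prop}
    (hs : Ensures k h p s A) (hAB : ∀ P, P.Over k h → A P → B P) : Ensures k h p s B :=
  fun P hR => ⟨(hs P hR).1, fun hO => hAB P hO ((hs P hR).2 hO)⟩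

/-- Player two may maintain an invariant of the positions in which player one is to move, provided
that every move of player one either connects or has a reply that restores the invariant. -/
theorem exists_ensures_two {w k h : ℕ} [NeZero w] (J : Position w → Prop)
    (start : J (Position.initial w))
    (turn : ∀ P, J P → P.turn = .one)
    (safe : ∀ P, J P → ¬ P.Connected k .two)
    (safe' : ∀ P c, J P → ¬ (P.play c).Connected k .two)
    (reply : ∀ P c, J P → P.Legal h c → ¬ (P.play c).Connected k .one →
      ∃ d, (P.play c).Legal h d ∧ J ((P.play c).play d)) :
    ∃ s : Strategy w, Ensures k h .two s fun P =>
      ¬ P.Connected k .two ∧ (J P ∨ P.Connected k .one) := by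
  -- With player two to move, either player one has connected or a reply restoring `J` exists; such
  -- a reply also shows that the board is not full.
  refine exists_ensures
    (fun P => J P ∨ (P.turn = .two ∧ ¬ P.Connected k .two ∧
      (P.Connected k .one ∨ ∃ d, P.Legal h d ∧ J (P.play d)))) _ (Or.inl start) ?_ ?_ ?_
  · rintro P (hJ | ⟨-, -, hc | ⟨d, hd, hJ⟩⟩) hO ht
    · simp [turn P hJ] at ht
    · exact (hO (Or.inl ⟨_, hc⟩)).elim
    · exact ⟨d, hd, Or.inl hJ⟩
  · rintro P c (hJ | ⟨ht', -⟩) hO ht hl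
    · right
      refine ⟨by simp [Position.play, turn P hJ, Player.opponent], safe' P c hJ, ?_⟩
      by_cases hc : (P.play c).Connected k .one
      · exact Or.inl hc
      · exact Or.inr (reply P c hJ hl hc)
    · exact (ht ht').elim
  · rintro P (hJ | ⟨-, h2, hc | ⟨d, hd, hJ⟩⟩) hO
    · exact ⟨safe P hJ, Or.inl hJ⟩
    · exact ⟨h2, Or.inr hc⟩
    · rcases hO with ⟨q, hq⟩ | hfull
      · cases q
        · exact ⟨h2, Or.inr hq⟩
        · exact (h2 hq).elim
      · exact (hfull d hd).elim

/-! ### Occupied cells and connections of length two -/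

namespace Position

variable {w : ℕ} {P : Position w} {q : Player} {x y : ℤ}

@[simp] theorem turn_play (P : Position w) (c : Fin w) : (P.play c).turn = P.turn.opponent := rfl

@[simp] theorem play_columns_self (P : Position w) (c : Fin w) :
    (P.play c).columns c = P.columns c ++ [P.turn] := by
  simp [play]

theorem play_columns_of_ne (P : Position w) {c d : Fin w} (h : d ≠ c) :
    (P.play c).columns d = P.columns d := by
  simp [play, h]

theorem not_occupies_initial : ¬ (initial w).Occupies q x y := by
  simp [Occupies, initial]

theorem occupies_natCast (c : Fin w) (r : ℕ) :
    P.Occupies q ((c : ℕ) : ℤ) r ↔ (P.columns c)[r]? = some q := by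
  constructor
  · rintro ⟨c', r', hc, hr, h⟩
    obtain rfl : c' = c := Fin.ext (by exact_mod_cast hc)
    obtain rfl : r' = r := by exact_mod_cast hr
    exact h
  · exact fun h => ⟨c, r, rfl, rfl, h⟩

theorem occupies_zero (c : Fin w) :
    P.Occupies q ((c : ℕ) : ℤ) 0 ↔ (P.columns c)[0]? = some q := by
  exact_mod_cast occupies_natCast (P := P) (q := q) c 0

theorem Occupies.mem_range (h : P.Occupies q x y) : 0 ≤ x ∧ x < w ∧ 0 ≤ y := by
  obtain ⟨c, r, rfl, rfl, -⟩ := h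
  have := c.isLt
  omega

theorem Occupies.unique {q' : Player} (h : P.Occupies q x y) (h' : P.Occupies q' x y) :
    q = q' := by
  obtain ⟨c, r, rfl, rfl, h⟩ := h
  rw [occupies_natCast, h] at h'
  simpa using h'

theorem occupies_play (c : Fin w) : (P.play c).Occupies q x y ↔
    P.Occupies q x y ∨ (q = P.turn ∧ x = ((c : ℕ) : ℤ) ∧ y = (P.columns c).length) := by
  have key : ∀ (d : Fin w) (r : ℕ), ((P.play c).columns d)[r]? = some q ↔
      (P.columns d)[r]? = some q ∨ (q = P.turn ∧ d = c ∧ r = (P.columns c).length) := by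
    intro d r
    by_cases hd : d = c
    · subst hd
      rw [play_columns_self]
      rcases lt_trichotomy r (P.columns d).length with hr | hr | hr
      · simp [List.getElem?_append_left hr, hr.ne]
      · simp [hr, eq_comm]
      · simp [List.getElem?_eq_none, hr.ne', Nat.succ_le_of_lt hr, hr.le]
    · simp [play_columns_of_ne P hd, hd]
  constructor
  · rintro ⟨d, r, rfl, rfl, h⟩
    rcases (key d r).1 h with h | ⟨h1, rfl, rfl⟩
    · exact Or.inl ⟨d, r, rfl, rfl, h⟩
    · exact Or.inr ⟨h1, rfl, rfl⟩
  · rintro (⟨d, r, rfl, rfl, h⟩ | ⟨h1, rfl, rfl⟩)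
    · exact ⟨d, r, rfl, rfl, (key d r).2 (Or.inl h)⟩
    · exact ⟨c, _, rfl, rfl, (key c _).2 (Or.inr ⟨h1, rfl, rfl⟩)⟩

/-- Connecting two means owning two cells a king's move apart. -/
theorem connected_two_iff : P.Connected 2 q ↔ ∃ x y x' y' : ℤ, P.Occupies q x y ∧
    P.Occupies q x' y' ∧ ¬ (x = x' ∧ y = y') ∧ |x - x'| ≤ 1 ∧ |y - y'| ≤ 1 := by
  constructor
  · rintro ⟨x, y, d, hd, h⟩
    have h0 := h 0 (by norm_num)
    have h1 := h 1 (by norm_num)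
    simp only [Nat.cast_zero, zero_mul, add_zero, Nat.cast_one, one_mul] at h0 h1
    refine ⟨x, y, _, _, h0, h1, ?_⟩
    simp only [directions, Finset.mem_insert, Finset.mem_singleton] at hd
    rcases hd with rfl | rfl | rfl | rfl <;> simp
  · have key : ∀ x y : ℤ, ∀ d ∈ directions, P.Occupies q x y →
        P.Occupies q (x + d.1) (y + d.2) → P.Connected 2 q := by
      intro x y d hd h0 h1
      refine ⟨x, y, d, hd, fun i hi => ?_⟩
      interval_cases i <;> simpa
    have mem : (1, 0) ∈ directions ∧ (0, 1) ∈ directions ∧ (1, 1) ∈ directions ∧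
        (1, -1) ∈ directions := by simp [directions]
    rintro ⟨x, y, x', y', h0, h1, hne, hx, hy⟩
    rw [abs_le] at hx hy
    obtain ⟨a, rfl⟩ : ∃ a, x' = x + a := ⟨x' - x, by ring⟩
    obtain ⟨b, rfl⟩ : ∃ b, y' = y + b := ⟨y' - y, by ring⟩
    have ha : a = -1 ∨ a = 0 ∨ a = 1 := by omega
    have hb : b = -1 ∨ b = 0 ∨ b = 1 := by omega
    -- Four of the eight king's moves lie in `directions`; the other four are their reverses.
    have swap : ∀ d ∈ directions, a = -d.1 → b = -d.2 → P.Connected 2 q := by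
      rintro d hd rfl rfl
      exact key _ _ d hd h1 (by simpa using h0)
    rcases ha with rfl | rfl | rfl <;> rcases hb with rfl | rfl | rfl
    · exact swap _ mem.2.2.1 rfl rfl
    · exact swap _ mem.1 rfl rfl
    · exact swap _ mem.2.2.2 rfl rfl
    · exact swap _ mem.2.1 rfl rfl
    · simp at hne
    · exact key _ _ _ mem.2.1 h0 h1
    · exact key _ _ _ mem.2.2.2 h0 h1
    · exact key _ _ _ mem.1 h0 h1
    · exact key _ _ _ mem.2.2.1 h0 h1

theorem connected_play_of_occupies (c : Fin w) (h : P.Occupies P.turn x y)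
    (hx : |x - ((c : ℕ) : ℤ)| ≤ 1) (hy : |y - (P.columns c).length| ≤ 1) :
    (P.play c).Connected 2 P.turn := by
  refine connected_two_iff.2 ⟨x, y, _, _, (occupies_play c).2 (Or.inl h),
    (occupies_play c).2 (Or.inr ⟨rfl, rfl, rfl⟩), ?_, hx, hy⟩
  rintro ⟨rfl, rfl⟩
  rw [occupies_natCast] at h
  simp at h

theorem Connected.of_play {c : Fin w} (h : (P.play c).Connected 2 q) (hP : ¬ P.Connected 2 q) :
    q = P.turn ∧ ∃ x y : ℤ, P.Occupies q x y ∧ |x - ((c : ℕ) : ℤ)| ≤ 1 ∧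
      |y - (P.columns c).length| ≤ 1 := by
  obtain ⟨x, y, x', y', h0, h1, hne, hx, hy⟩ := connected_two_iff.1 h
  rcases (occupies_play c).1 h0 with h0 | ⟨hq, rfl, rfl⟩ <;>
    rcases (occupies_play c).1 h1 with h1 | ⟨hq', rfl, rfl⟩
  · exact (hP (connected_two_iff.2 ⟨x, y, x', y', h0, h1, hne, hx, hy⟩)).elim
  · exact ⟨hq', x, y, h0, hx, hy⟩
  · exact ⟨hq, x', y', h1, by rwa [abs_sub_comm], by rwa [abs_sub_comm]⟩
  · exact (hne ⟨rfl, rfl⟩).elim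

theorem not_connected_initial : ¬ (initial w).Connected 2 q := by
  rw [connected_two_iff]
  rintro ⟨x, y, x', y', h, -⟩
  exact not_occupies_initial h

theorem exists_occupies (c : Fin w) {r : ℕ} (hr : r < (P.columns c).length) :
    ∃ q, P.Occupies q ((c : ℕ) : ℤ) r :=
  ⟨(P.columns c)[r], (occupies_natCast c r).2 (List.getElem?_eq_getElem hr)⟩

/-- On a full board with at least two rows and two columns somebody has connected two. -/
theorem exists_connected_of_full {h : ℕ} (hw : 1 < w) (hh : 1 < h)
    (full : ∀ c, ¬ P.Legal h c) : ∃ q, P.Connected 2 q := by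
  have occ : ∀ x y : ℕ, x < 2 → y < 2 → ∃ q, P.Occupies q x y := fun x y hx hy =>
    exists_occupies (⟨x, by omega⟩ : Fin w) (by
      have := full ⟨x, by omega⟩
      simp only [Legal] at this
      omega)
  -- These three corner cells are pairwise a king's move apart, and two of them share an owner.
  obtain ⟨a, ha⟩ := occ 0 0 (by norm_num) (by norm_num)
  obtain ⟨b, hb⟩ := occ 1 0 (by norm_num) (by norm_num)
  obtain ⟨c, hc⟩ := occ 1 1 (by norm_num) (by norm_num)
  have : a = b ∨ a = c ∨ b = c := by cases a <;> cases b <;> cases c <;> simp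
  rcases this with rfl | rfl | rfl
  · exact ⟨_, connected_two_iff.2 ⟨_, _, _, _, ha, hb, by simp, by simp, by simp⟩⟩
  · exact ⟨_, connected_two_iff.2 ⟨_, _, _, _, ha, hc, by simp, by simp, by simp⟩⟩
  · exact ⟨_, connected_two_iff.2 ⟨_, _, _, _, hb, hc, by simp, by simp, by simp⟩⟩

/-- The number of pieces on the board. -/
def pieces (P : Position w) : ℕ := ∑ c, (P.columns c).length

theorem pieces_play (c : Fin w) : (P.play c).pieces = P.pieces + 1 := by
  classical
  unfold pieces
  rw [← Finset.add_sum_erase _ _ (Finset.mem_univ c), ← Finset.add_sum_erase (a := c) _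
    (fun d => (P.columns d).length) (Finset.mem_univ c),
    Finset.sum_congr rfl fun d hd => by rw [play_columns_of_ne P (Finset.ne_of_mem_erase hd)]]
  simp
  omega

end Position

/-! ### A single row -/

section SingleRow

/-- The cell `x` of a row of width `w` holds no piece; `O` and `T` are the cells of the two
players. -/
def Vacant (w : ℤ) (O T : ℤ → Prop) (x : ℤ) : Prop := 0 ≤ x ∧ x < w ∧ ¬ O x ∧ ¬ T x

/-- If player one can safely play at `c`, then player two can safely reply at `c + 1`. -/
def RightReply (w : ℤ) (O T : ℤ → Prop) (c : ℤ) : Prop :=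
  Vacant w O T c → ¬ O (c - 1) → ¬ O (c + 1) → Vacant w O T (c + 1) ∧ ¬ T (c + 2)

/-- If player one can safely play at `c`, then player two can safely reply at `c - 1`. -/
def LeftReply (w : ℤ) (O T : ℤ → Prop) (c : ℤ) : Prop :=
  Vacant w O T c → ¬ O (c - 1) → ¬ O (c + 1) → Vacant w O T (c - 1) ∧ ¬ T (c - 2)

/-- Player two can always reply directly to the right of player one. -/
def RightClosed (w : ℤ) (O T : ℤ → Prop) : Prop := ∀ c, RightReply w O T c

/-- Player two can always reply directly to the left of player one. -/
def LeftClosed (w : ℤ) (O T : ℤ → Prop) : Prop := ∀ c, LeftReply w O T c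

/-- Both ends are untouched, and only the last cell lacks a reply on its right. -/
def OpenEnds (w : ℤ) (O T : ℤ → Prop) : Prop :=
  2 ≤ w ∧ Vacant w O T 0 ∧ Vacant w O T (w - 1) ∧ Vacant w O T (w - 2) ∧ ¬ T 1 ∧
    ∀ c, c ≠ w - 1 → RightReply w O T c

/-- The players hold one end each, and player two keeps cell `1` in reserve. -/
def ExchangedEnds (w : ℤ) (O T : ℤ → Prop) : Prop :=
  4 ≤ w ∧ O 0 ∧ T (w - 1) ∧ Vacant w O T 1 ∧ ¬ T 2 ∧
    ∀ c, c ≠ w - 2 → c ≠ w - 3 → RightReply w O T c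

/-- A reply of player two at `r` to the move `c` of player one that leads to `S`. -/
def Reply (w : ℤ) (O T : ℤ → Prop) (c : ℤ) (S : (ℤ → Prop) → (ℤ → Prop) → Prop) (r : ℤ) : Prop :=
  Vacant w O T r ∧ r ≠ c ∧ ¬ T (r - 1) ∧ ¬ T (r + 1) ∧
    S (fun x => O x ∨ x = c) (fun x => T x ∨ x = r)

variable {w : ℤ} {O T : ℤ → Prop} {c r : ℤ}

/-- Player one can play at `c` without connecting. -/
def Playable (w : ℤ) (O T : ℤ → Prop) (c : ℤ) : Prop := Vacant w O T c ∧ ¬ O (c - 1) ∧ ¬ O (c + 1)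

/-- Only cells `d` still playable for player one matter, so `d` is neither `c` nor next to it. The
old reply at `d + 1` can then be spoiled only by a piece of player two landing on `d + 1` or `d +
2`. -/
theorem rightReply_play {d : ℤ} (h : 0 ≤ d → d < w → ¬ O d → ¬ O (d - 1) → ¬ O (d + 1) → d ≠ r →
    d ≠ c → d ≠ c - 1 → d ≠ c + 1 → RightReply w O T d ∧ r ≠ d + 1 ∧ r ≠ d + 2) :
    RightReply w (fun x => O x ∨ x = c) (fun x => T x ∨ x = r) d := by
  rintro ⟨h0, hw, hO, hT⟩ h1 h2
  push Not at hO hT h1 h2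
  obtain ⟨hR, n1, n2⟩ := h h0 hw hO.1 h1.1 h2.1 hT.2 hO.2 (by omega) (by omega)
  obtain ⟨⟨a, b, e, f⟩, g⟩ := hR ⟨h0, hw, hO.1, hT.1⟩ h1.1 h2.1
  exact ⟨⟨a, b, by simpa [e] using h2.2, by simpa [f] using n1.symm⟩, by simpa [g] using n2.symm⟩

theorem leftReply_play {d : ℤ} (h : 0 ≤ d → d < w → ¬ O d → ¬ O (d - 1) → ¬ O (d + 1) → d ≠ r →
    d ≠ c → d ≠ c - 1 → d ≠ c + 1 → LeftReply w O T d ∧ r ≠ d - 1 ∧ r ≠ d - 2) :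
    LeftReply w (fun x => O x ∨ x = c) (fun x => T x ∨ x = r) d := by
  rintro ⟨h0, hw, hO, hT⟩ h1 h2
  push Not at hO hT h1 h2
  obtain ⟨hR, n1, n2⟩ := h h0 hw hO.1 h1.1 h2.1 hT.2 hO.2 (by omega) (by omega)
  obtain ⟨⟨a, b, e, f⟩, g⟩ := hR ⟨h0, hw, hO.1, hT.1⟩ h1.1 h2.1
  exact ⟨⟨a, b, by simpa [e] using h1.2, by simpa [f] using n1.symm⟩, by simpa [g] using n2.symm⟩

theorem vacant_play {x : ℤ} (h : Vacant w O T x) (hc : x ≠ c) (hr : x ≠ r) :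
    Vacant w (fun x => O x ∨ x = c) (fun x => T x ∨ x = r) x := by
  obtain ⟨a, b, e, f⟩ := h
  exact ⟨a, b, by simp [e, hc], by simp [f, hr]⟩

theorem RightReply.reply (h : RightReply w O T c) (hc : Playable w O T c)
    {S : (ℤ → Prop) → (ℤ → Prop) → Prop}
    (hS : S (fun x => O x ∨ x = c) (fun x => T x ∨ x = c + 1)) : Reply w O T c S (c + 1) := by
  obtain ⟨hv, h1, h2⟩ := hc
  obtain ⟨hv', h3⟩ := h hv h1 h2
  refine ⟨hv', by omega, by simpa using hv.2.2.2, by rwa [add_assoc], hS⟩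

theorem LeftReply.reply (h : LeftReply w O T c) (hc : Playable w O T c)
    {S : (ℤ → Prop) → (ℤ → Prop) → Prop}
    (hS : S (fun x => O x ∨ x = c) (fun x => T x ∨ x = c - 1)) : Reply w O T c S (c - 1) := by
  obtain ⟨hv, h1, h2⟩ := hc
  obtain ⟨hv', h3⟩ := h hv h1 h2
  refine ⟨hv', by omega, by rwa [sub_sub], by simpa using hv.2.2.2, hS⟩

/-- The reply at `c + 1` spoils only `c` and `c - 1`, and neither is playable any more. -/
theorem RightClosed.reply (h : RightClosed w O T) (hc : Playable w O T c) :
    Reply w O T c (RightClosed w) (c + 1) :=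
  (h c).reply hc fun d => rightReply_play fun _ _ _ _ _ _ _ _ _ => ⟨h d, by omega, by omega⟩

theorem LeftClosed.reply (h : LeftClosed w O T) (hc : Playable w O T c) :
    Reply w O T c (LeftClosed w) (c - 1) :=
  (h c).reply hc fun d => leftReply_play fun _ _ _ _ _ _ _ _ _ => ⟨h d, by omega, by omega⟩

/-- Cell `0` is a spare move: it is nobody's right reply, so it answers a move at `w - 1`, which has
no cell on its right. -/
theorem OpenEnds.reply (h : OpenEnds w O T) (hT : ∀ x, T x → 0 ≤ x ∧ x < w)
    (hc : Playable w O T c) :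
    Reply w O T c (RightClosed w) 0 ∧ c = w - 1 ∨
      Reply w O T c (RightClosed w) (w - 1) ∧ c = w - 2 ∨
      Reply w O T c (RightClosed w) (w - 1) ∧ c = w - 3 ∨
      Reply w O T c (ExchangedEnds w) (w - 1) ∧ 4 ≤ w ∨
      Reply w O T c (OpenEnds w) (c + 1) := by
  have ⟨hw, a0, a1, a2, a3, a4⟩ := h
  have hm : ¬ T (-1) := fun h => by have := hT _ h; omega
  have hM : ¬ T (w - 1 + 1) := fun h => by have := hT _ h; omega
  have hM' : ¬ T (w - 1 - 1) := by rw [sub_sub]; exact a2.2.2.2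
  have hc0 := hc.1.1
  have hcw := hc.1.2.1
  by_cases e1 : c = w - 1
  · left
    refine ⟨⟨a0, by omega, hm, a3, fun d => rightReply_play fun _ _ _ _ _ _ _ _ _ => ?_⟩, e1⟩
    exact ⟨a4 d (by omega), by omega, by omega⟩
  -- A reply at `w - 1` spoils `w - 2` and `w - 3`; one of them is `c` and the other is next to `c`.
  have closed : c = w - 2 ∨ c = w - 3 → Reply w O T c (RightClosed w) (w - 1) := by
    intro e
    refine ⟨a1, by omega, hM', hM, fun d => rightReply_play fun _ _ _ _ _ _ _ _ _ => ?_⟩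
    exact ⟨a4 d (by omega), by omega, by omega⟩
  by_cases e2 : c = w - 2
  · exact Or.inr (Or.inl ⟨closed (Or.inl e2), e2⟩)
  by_cases e3 : c = w - 3
  · exact Or.inr (Or.inr (Or.inl ⟨closed (Or.inr e3), e3⟩))
  right; right; right
  -- Here player one takes the spare cell. Player two takes the other end, and cell `1`, now barred
  -- to player one, becomes the spare.
  by_cases e4 : c = 0
  · left
    subst e4
    refine ⟨⟨a1, by omega, hM', hM, by omega, by simp, by simp, ?_, ?_, fun d _ _ =>
      rightReply_play fun _ _ _ _ _ _ _ _ _ => ?_⟩, by omega⟩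
    · exact ⟨by omega, by omega, by simpa using hc.2.2, by simp [a3]; omega⟩
    · obtain ⟨-, h2⟩ := a4 0 (by omega) hc.1 hc.2.1 hc.2.2
      simp only [zero_add] at h2
      simp [h2]; omega
    · exact ⟨a4 d (by omega), by omega, by omega⟩
  · right
    refine (a4 c e1).reply hc ⟨hw, vacant_play a0 (by omega) (by omega),
      vacant_play a1 (by omega) (by omega), vacant_play a2 (by omega) (by omega),
      by simp [a3]; omega, fun d hd => rightReply_play fun _ _ _ _ _ _ _ _ _ => ?_⟩
    exact ⟨a4 d hd, by omega, by omega⟩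

/-- The piece at `w - 1` has spoiled only `w - 2` and `w - 3`. These are adjacent, so player one can
use at most one of them, and a single spare move at `1` suffices. -/
theorem ExchangedEnds.reply (h : ExchangedEnds w O T) (hOT : ∀ x, O x → ¬ T x)
    (hc : Playable w O T c) :
    Reply w O T c (RightClosed w) 1 ∨ Reply w O T c (ExchangedEnds w) (c + 1) := by
  have ⟨hw, a0, a1, a2, a3, a4⟩ := h
  have hc0 := hc.1.1
  have hcw := hc.1.2.1
  have n0 : c ≠ 0 := by rintro rfl; exact hc.1.2.2.1 a0
  have n1 : c ≠ 1 := by rintro rfl; exact hc.2.1 (by simpa using a0)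
  have nw : c ≠ w - 1 := by rintro rfl; exact hc.1.2.2.2 a1
  by_cases e : c = w - 2 ∨ c = w - 3
  · left
    refine ⟨a2, by omega, ?_, by simpa using a3, fun d => rightReply_play
      fun _ _ _ _ _ _ _ _ _ => ?_⟩
    · simpa using hOT 0 a0
    · have : d ≠ 0 := by rintro rfl; contradiction
      exact ⟨a4 d (by omega) (by omega), by omega, by omega⟩
  · right
    refine (a4 c (by omega) (by omega)).reply hc ⟨hw, Or.inl a0, Or.inl a1,
      vacant_play a2 (by omega) (by omega), by simp [a3]; omega, fun d _ _ => rightReply_play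
      fun _ _ _ _ _ _ _ _ _ => ?_⟩
    exact ⟨a4 d (by omega) (by omega), by omega, by omega⟩

/-- Every piece of player two has a neighbour of the other colour, unless it is at an end. -/
def Supported (w : ℤ) (O T : ℤ → Prop) : Prop :=
  ∀ x, T x → O (x - 1) ∨ O (x + 1) ∨ 3 ≤ w ∧ (x = 0 ∨ x = w - 1)

/-- The alternatives for `r` are the replies in use: beside `c`, the spare cell beside player one's
piece at `0`, or an end. -/
theorem Supported.play (h : Supported w O T)
    (hr : r = c + 1 ∨ r = c - 1 ∨ O (r - 1) ∨ 3 ≤ w ∧ (r = 0 ∨ r = w - 1)) :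
    Supported w (fun x => O x ∨ x = c) (fun x => T x ∨ x = r) := by
  rintro x (hx | rfl)
  · rcases h x hx with h | h | h
    · exact Or.inl (Or.inl h)
    · exact Or.inr (Or.inl (Or.inl h))
    · exact Or.inr (Or.inr h)
  · rcases hr with h | h | h | h
    · exact Or.inl (Or.inr (by omega))
    · exact Or.inr (Or.inl (Or.inr (by omega)))
    · exact Or.inl (Or.inl h)
    · exact Or.inr (Or.inr h)

/-- The bottom rows that player two maintains on boards of odd height. -/
def SafeRow (w : ℤ) (O T : ℤ → Prop) : Prop :=
  (RightClosed w O T ∨ OpenEnds w O T ∨ ExchangedEnds w O T) ∧ Supported w O T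

theorem Reply.imp {S S' : (ℤ → Prop) → (ℤ → Prop) → Prop} (h : Reply w O T c S r)
    (hS : S (fun x => O x ∨ x = c) (fun x => T x ∨ x = r) →
      S' (fun x => O x ∨ x = c) (fun x => T x ∨ x = r)) : Reply w O T c S' r :=
  ⟨h.1, h.2.1, h.2.2.1, h.2.2.2.1, hS h.2.2.2.2⟩

theorem safeRow_empty (hw : 2 ≤ w) : SafeRow w (fun _ => False) (fun _ => False) := by
  refine ⟨Or.inr (Or.inl ?_), fun x hx => hx.elim⟩
  simp only [OpenEnds, RightReply, Vacant]
  refine ⟨hw, ?_, ?_, ?_, ?_, fun d _ _ _ _ => ?_⟩ <;> simp <;> omega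

theorem SafeRow.reply (h : SafeRow w O T) (hT : ∀ x, T x → 0 ≤ x ∧ x < w)
    (hOT : ∀ x, O x → ¬ T x) (hc : Playable w O T c) : ∃ r, Reply w O T c (SafeRow w) r := by
  obtain ⟨h | h | h, hs⟩ := h
  · exact ⟨_, (h.reply hc).imp fun h => ⟨Or.inl h, hs.play (Or.inl rfl)⟩⟩
  · have hw := h.1
    rcases h.reply hT hc with ⟨h, e⟩ | ⟨h, e⟩ | ⟨h, e⟩ | ⟨h, e⟩ | h
    · exact ⟨_, h.imp fun h => ⟨Or.inl h, hs.play (by omega)⟩⟩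
    · exact ⟨_, h.imp fun h => ⟨Or.inl h, hs.play (by omega)⟩⟩
    · exact ⟨_, h.imp fun h => ⟨Or.inl h, hs.play (by have := hc.1.1; omega)⟩⟩
    · exact ⟨_, h.imp fun h => ⟨Or.inr (Or.inr h), hs.play (by omega)⟩⟩
    · exact ⟨_, h.imp fun h => ⟨Or.inr (Or.inl h), hs.play (Or.inl rfl)⟩⟩
  · rcases h.reply hOT hc with h' | h'
    · exact ⟨_, h'.imp fun h' => ⟨Or.inl h', hs.play (by simp [h.2.1])⟩⟩
    · exact ⟨_, h'.imp fun h' => ⟨Or.inr (Or.inr h'), hs.play (Or.inl rfl)⟩⟩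

/-! ### A single row of even width: avoiding a full board -/

/-- The players hold cells of the same parity, so the row cannot be filled alternately. -/
def Clashing (O T : ℤ → Prop) : Prop := ∃ x y, O x ∧ T y ∧ Even (x - y)

theorem Clashing.play (h : Clashing O T) :
    Clashing (fun x => O x ∨ x = c) (fun x => T x ∨ x = r) := by
  obtain ⟨x, y, hx, hy, h⟩ := h
  exact ⟨x, y, Or.inl hx, Or.inl hy, h⟩

/-- Player one has cut off the last three cells, where player two keeps cell `w - 3` in reserve. -/
def TailReserve (w : ℤ) (O T : ℤ → Prop) : Prop :=
  O (w - 4) ∧ Vacant w O T (w - 3) ∧ Vacant w O T (w - 2) ∧ Vacant w O T (w - 1) ∧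
    ∀ c, c ≠ w - 1 → RightReply w O T c

/-- Player one holds cells `w - 1` and `w - 3`, and player two keeps the cell between them in
reserve for a move of player one at `w - 6` or `w - 7`. -/
def GapReserve (w : ℤ) (O T : ℤ → Prop) : Prop :=
  O (w - 1) ∧ O (w - 3) ∧ Vacant w O T (w - 2) ∧
    ∀ c, c ≠ w - 6 → c ≠ w - 7 → RightReply w O T c

/-- The piece at `w - 4` bars player one from `w - 3`. Of the last two cells player one gets at most
one: `w - 1` is answered by the spare `w - 3`, and `w - 2` by `w - 1`. -/
theorem TailReserve.reply (h : TailReserve w O T) (hOT : ∀ x, O x → ¬ T x)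
    (hc : Playable w O T c) :
    Reply w O T c (RightClosed w) (w - 3) ∨ Reply w O T c (RightClosed w) (c + 1) ∨
      Reply w O T c (TailReserve w) (c + 1) := by
  obtain ⟨a0, a1, a2, a3, a4⟩ := h
  have hcw := hc.1.2.1
  have n3 : c ≠ w - 3 := by rintro rfl; exact hc.2.1 (by rwa [sub_sub])
  have n4 : c ≠ w - 4 := by rintro rfl; exact hc.1.2.2.1 a0
  have n5 : c ≠ w - 5 := by rintro rfl; exact hc.2.2 (by convert a0 using 1; ring)
  by_cases e1 : c = w - 1
  · left
    refine ⟨a1, by omega, ?_, ?_, fun d => rightReply_play fun _ _ _ _ _ _ _ _ _ => ?_⟩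
    · rw [sub_sub]; exact hOT _ a0
    · convert a2.2.2.2 using 2; ring
    · have : d ≠ w - 4 := by rintro rfl; contradiction
      have : d ≠ w - 5 := by
        rintro rfl
        have : w - 5 + 1 = w - 4 := by ring
        simp_all
      exact ⟨a4 d (by omega), by omega, by omega⟩
  right
  by_cases e2 : c = w - 2
  · left
    refine (a4 c e1).reply hc fun d => rightReply_play fun _ _ _ _ _ _ _ _ _ => ?_
    exact ⟨a4 d (by omega), by omega, by omega⟩
  · right
    refine (a4 c e1).reply hc ⟨Or.inl a0, vacant_play a1 (by omega) (by omega),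
      vacant_play a2 (by omega) (by omega), vacant_play a3 (by omega) (by omega),
      fun d hd => rightReply_play fun _ _ _ _ _ _ _ _ _ => ?_⟩
    exact ⟨a4 d hd, by omega, by omega⟩

/-- The two cells without a right reply are adjacent, so one spare move suffices; player one cannot
enter the gap without connecting. -/
theorem GapReserve.reply (h : GapReserve w O T) (hOT : ∀ x, O x → ¬ T x)
    (hc : Playable w O T c) :
    Reply w O T c (RightClosed w) (w - 2) ∨ Reply w O T c (GapReserve w) (c + 1) := by
  obtain ⟨a0, a1, a2, a3⟩ := h
  have hcw := hc.1.2.1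
  have n2 : c ≠ w - 2 := by rintro rfl; exact hc.2.1 (by rwa [sub_sub])
  have n3 : c ≠ w - 3 := by rintro rfl; exact hc.1.2.2.1 a1
  by_cases e : c = w - 6 ∨ c = w - 7
  · left
    refine ⟨a2, by omega, ?_, ?_, fun d => rightReply_play fun _ _ _ _ _ _ _ _ _ => ?_⟩
    · rw [sub_sub]; exact hOT _ a1
    · convert hOT _ a0 using 2; ring
    · have : d ≠ w - 3 := by rintro rfl; contradiction
      have : d ≠ w - 4 := by
        rintro rfl
        have : w - 4 + 1 = w - 3 := by ring
        simp_all
      exact ⟨a3 d (by omega) (by omega), by omega, by omega⟩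
  · right
    refine (a3 c (by omega) (by omega)).reply hc ⟨Or.inl a0, Or.inl a1,
      vacant_play a2 (by omega) (by omega),
      fun d _ _ => rightReply_play fun _ _ _ _ _ _ _ _ _ => ?_⟩
    exact ⟨a3 d (by omega) (by omega), by omega, by omega⟩

/-- The single rows in which player two can prevent a draw and a loss. -/
def WinningRow (w : ℤ) (O T : ℤ → Prop) : Prop :=
  (∀ x, ¬ O x ∧ ¬ T x) ∨
  (∀ x, (O x ↔ x = w - 1) ∧ (T x ↔ x = 0)) ∨
  (∀ x, (O x ↔ x = 0) ∧ (T x ↔ x = w - 1)) ∨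
  Clashing O T ∧ (RightClosed w O T ∨ LeftClosed w O T ∨ OpenEnds w O T ∨ ExchangedEnds w O T ∨
    TailReserve w O T ∨ GapReserve w O T)

theorem winningRow_of_clashing (h : Clashing O T) (h' : RightClosed w O T ∨ LeftClosed w O T ∨
    OpenEnds w O T ∨ ExchangedEnds w O T ∨ TailReserve w O T ∨ GapReserve w O T) :
    WinningRow w O T := Or.inr (Or.inr (Or.inr ⟨h, h'⟩))

/-- Each reply is at even distance from `c`, unless `c` is an end. The ends have opposite parity as
`w` is even, so then the clash is left to the next reply. A reply at `c + 2` spoils only `c` and `c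
+ 1`, hence nothing. -/
theorem exists_reply_of_empty (hw : 8 ≤ w) (hev : Even w) (h : ∀ x, ¬ O x ∧ ¬ T x)
    (hc : 0 ≤ c ∧ c < w) : ∃ r, Reply w O T c (WinningRow w) r := by
  obtain ⟨m, hm⟩ := hev
  by_cases e0 : c = 0
  · refine ⟨w - 1, ?_, by omega, (h _).2, (h _).2, Or.inr (Or.inr (Or.inl ?_))⟩
    · simp [Vacant, h]; omega
    · simp [h, e0]
  by_cases e1 : c = w - 1
  · refine ⟨0, ?_, by omega, (h _).2, (h _).2, Or.inr (Or.inl ?_)⟩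
    · simp [Vacant, h]; omega
    · simp [h, e1]
  by_cases e2 : c = w - 2
  · refine ⟨0, ?_, by omega, (h _).2, (h _).2, winningRow_of_clashing
      ⟨c, 0, Or.inr rfl, Or.inr rfl, m - 1, by omega⟩ (Or.inl ?_)⟩
    · simp [Vacant, h]; omega
    · simp only [RightClosed, RightReply, Vacant, h, false_or]; omega
  by_cases e3 : c = w - 3
  · refine ⟨w - 1, ?_, by omega, (h _).2, (h _).2, winningRow_of_clashing
      ⟨c, w - 1, Or.inr rfl, Or.inr rfl, -1, by omega⟩ (Or.inl ?_)⟩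
    · simp [Vacant, h]; omega
    · simp only [RightClosed, RightReply, Vacant, h, false_or]; omega
  by_cases e4 : c = w - 4
  · refine ⟨0, ?_, by omega, (h _).2, (h _).2, winningRow_of_clashing
      ⟨c, 0, Or.inr rfl, Or.inr rfl, m - 2, by omega⟩
      (Or.inr (Or.inr (Or.inr (Or.inr (Or.inl ?_)))))⟩
    · simp [Vacant, h]; omega
    · simp only [TailReserve, RightReply, Vacant, h, false_or]
      refine ⟨?_, ?_, ?_, ?_, fun d => ?_⟩ <;> omega
  · refine ⟨c + 2, ?_, by omega, (h _).2, (h _).2, winningRow_of_clashing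
      ⟨c, c + 2, Or.inr rfl, Or.inr rfl, -1, by omega⟩
      (Or.inr (Or.inr (Or.inl ?_)))⟩
    · simp [Vacant, h]; omega
    · simp only [OpenEnds, RightReply, Vacant, h, false_or]
      refine ⟨hw.trans' (by norm_num), ?_, ?_, ?_, ?_, fun d => ?_⟩ <;> omega

theorem exists_reply_of_last (hw : 8 ≤ w) (h : ∀ x, (O x ↔ x = w - 1) ∧ (T x ↔ x = 0))
    (hc : Playable w O T c) : ∃ r, Reply w O T c (WinningRow w) r := by
  simp only [Playable, Vacant, h] at hc
  -- Here `c + 2` is taken, so player two replies at `c - 2`, spoiling `w - 6` and `w - 7`. For `w =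
  -- 6` this cell would touch player two's piece at `0`.
  by_cases e3 : c = w - 3
  · refine ⟨w - 5, ?_, by omega, ?_, ?_, winningRow_of_clashing
      ⟨c, w - 5, Or.inr rfl, Or.inr rfl, 1, by omega⟩
      (Or.inr (Or.inr (Or.inr (Or.inr (Or.inr ?_)))))⟩
    · simp [Vacant, h]; omega
    · simp only [h]; omega
    · simp only [h]; omega
    · simp only [GapReserve, RightReply, Vacant, h, true_or, true_and]
      refine ⟨?_, ?_, fun d _ _ => ?_⟩ <;> omega
  · refine ⟨c + 2, ?_, by omega, ?_, ?_, winningRow_of_clashing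
      ⟨c, c + 2, Or.inr rfl, Or.inr rfl, -1, by omega⟩ (Or.inl ?_)⟩
    · simp only [Vacant, h]; omega
    · simp only [h]; omega
    · simp only [h]; omega
    · simp only [RightClosed, RightReply, Vacant, h]; omega

theorem exists_reply_of_first (hw : 8 ≤ w) (h : ∀ x, (O x ↔ x = 0) ∧ (T x ↔ x = w - 1))
    (hc : Playable w O T c) : ∃ r, Reply w O T c (WinningRow w) r := by
  simp only [Playable, Vacant, h] at hc
  -- Here `c - 2` is taken, so player two replies at `4`, which for `w = 6` would touch player two's
  -- piece at `w - 1`.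
  by_cases e2 : c = 2
  · refine ⟨4, ?_, by omega, ?_, ?_, winningRow_of_clashing
      ⟨c, 4, Or.inr rfl, Or.inr rfl, -1, by omega⟩
      (Or.inr (Or.inr (Or.inr (Or.inl ?_))))⟩
    · simp only [Vacant, h]; omega
    · simp only [h]; omega
    · simp only [h]; omega
    · simp only [ExchangedEnds, RightReply, Vacant, h, true_or, true_and]
      refine ⟨?_, ?_, ?_, fun d _ _ => ?_⟩ <;> omega
  · refine ⟨c - 2, ?_, by omega, ?_, ?_, winningRow_of_clashing
      ⟨c, c - 2, Or.inr rfl, Or.inr rfl, 1, by omega⟩ (Or.inr (Or.inl ?_))⟩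
    · simp only [Vacant, h]; omega
    · simp only [h]; omega
    · simp only [h]; omega
    · simp only [LeftClosed, LeftReply, Vacant, h]; omega

theorem WinningRow.reply (hw : 8 ≤ w) (hev : Even w) (h : WinningRow w O T)
    (hT : ∀ x, T x → 0 ≤ x ∧ x < w) (hOT : ∀ x, O x → ¬ T x) (hc : Playable w O T c) :
    ∃ r, Reply w O T c (WinningRow w) r := by
  obtain h | h | h | ⟨hcl, h⟩ := h
  · exact exists_reply_of_empty hw hev h ⟨hc.1.1, hc.1.2.1⟩
  · exact exists_reply_of_last hw h hc
  · exact exists_reply_of_first hw h hc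
  have key : ∀ {r} {S : (ℤ → Prop) → (ℤ → Prop) → Prop}, Reply w O T c S r →
      (∀ {O T}, S O T → RightClosed w O T ∨ LeftClosed w O T ∨ OpenEnds w O T ∨
        ExchangedEnds w O T ∨ TailReserve w O T ∨ GapReserve w O T) →
      ∃ r, Reply w O T c (WinningRow w) r :=
    fun hr hS => ⟨_, hr.imp fun h => winningRow_of_clashing hcl.play (hS h)⟩
  obtain h | h | h | h | h | h := h
  · exact key (h.reply hc) (by tauto)
  · exact key (h.reply hc) (by tauto)
  · obtain ⟨h, -⟩ | ⟨h, -⟩ | ⟨h, -⟩ | ⟨h, -⟩ | h := h.reply hT hc <;> exact key h (by tauto)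
  · obtain h | h := h.reply hOT hc <;> exact key h (by tauto)
  · obtain h | h | h := h.reply hOT hc <;> exact key h (by tauto)
  · obtain h | h := h.reply hOT hc <;> exact key h (by tauto)

end SingleRow

open Position

/-! ### Boards of even height -/

/-- On a board of even height and at least two columns, player two wins by always playing on top of
the last piece of player one. -/
theorem winFor_two_of_even_height {w h : ℕ} (hw : 1 < w) (hh : 1 ≤ h) (he : Even h) :
    WinFor 2 w h .two := by
  have : NeZero w := ⟨by omega⟩
  let J : Position w → Prop := fun P => P.turn = .one ∧ (∀ c, Even (P.columns c).length) ∧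
    (∀ x y, P.Occupies .one x y → Even y) ∧
    (∀ x y, P.Occupies .two x y → Odd y ∧ P.Occupies .one x (y - 1)) ∧ ¬ P.Connected 2 .two
  have safe : ∀ P c, J P → ¬ (P.play c).Connected 2 .two := by
    rintro P c ⟨ht, -, -, -, h2⟩ hc
    have := (hc.of_play h2).1
    simp [ht] at this
  have reply : ∀ P c, J P → P.Legal h c → ¬ (P.play c).Connected 2 .one →
      ∃ d, (P.play c).Legal h d ∧ J ((P.play c).play d) := by
    rintro P c ⟨ht, hlen, h1, h2, hn⟩ hl hc
    set Q := P.play c with hQ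
    have hQt : Q.turn = .two := by simp [hQ, ht, Player.opponent]
    have hQlen : (Q.columns c).length = (P.columns c).length + 1 := by simp [hQ]
    have o1 : ∀ x y, (Q.play c).Occupies .one x y → Even y := by
      intro x y ho
      rw [occupies_play, hQt, hQ, occupies_play] at ho
      rcases ho with (ho | ⟨-, -, rfl⟩) | ⟨h, -⟩
      · exact h1 x y ho
      · exact_mod_cast hlen c
      · simp at h
    have o2 : ∀ x y, (Q.play c).Occupies .two x y →
        Odd y ∧ (Q.play c).Occupies .one x (y - 1) := by
      intro x y ho
      rw [occupies_play, hQt, hQlen, hQ, occupies_play, ht] at ho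
      rcases ho with (ho | ⟨h, -⟩) | ⟨-, rfl, rfl⟩
      · obtain ⟨a, b⟩ := h2 x y ho
        exact ⟨a, (occupies_play c).2 (Or.inl ((occupies_play c).2 (Or.inl b)))⟩
      · simp at h
      · refine ⟨by exact_mod_cast (hlen c).add_one, (occupies_play c).2 (Or.inl
          ((occupies_play c).2 (Or.inr ⟨ht.symm, rfl, by simp⟩)))⟩
    have hone : ¬ (Q.play c).Connected 2 .one := fun h => by
      have := (h.of_play hc).1
      simp [hQt] at this
    refine ⟨c, ?_, by simp [hQt, Player.opponent], fun d => ?_, o1, o2, fun h => ?_⟩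
    · simp only [Legal] at hl ⊢
      obtain ⟨m, hm⟩ := he
      obtain ⟨n, hn⟩ := hlen c
      omega
    · by_cases hd : d = c
      · subst hd
        simp [hQlen, add_assoc, Nat.even_add, hlen d]
      · rw [play_columns_of_ne _ hd, play_columns_of_ne _ hd]
        exact hlen d
    -- A connection of player two, shifted down by one, is one of player one.
    · obtain ⟨x, y, x', y', ha, hb, hne, hx, hy⟩ := connected_two_iff.1 h
      exact hone (connected_two_iff.2 ⟨x, y - 1, x', y' - 1, (o2 x y ha).2, (o2 x' y' hb).2,
        by omega, hx, by simpa using hy⟩)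
  obtain ⟨s, hs⟩ := exists_ensures_two (k := 2) (h := h) J
    ⟨rfl, by simp [initial], fun _ _ h => (not_occupies_initial h).elim,
      fun _ _ h => (not_occupies_initial h).elim, not_connected_initial⟩
    (fun P hP => hP.1) (fun P hP => hP.2.2.2.2) safe reply
  refine ⟨s, hs.mono ?_⟩
  rintro P (⟨q, hq⟩ | hfull) ⟨h2, hJ⟩
  · cases q
    · exact hq
    · exact (h2 hq).elim
  · obtain ⟨q, hq⟩ := exists_connected_of_full hw (by obtain ⟨m, rfl⟩ := he; omega) hfull
    cases q
    · exact hq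
    · exact (h2 hq).elim

/-! ### Boards with a single column -/

/-- Play is forced and the owners alternate by row, so vertically adjacent pieces never agree. -/
theorem isDraw_one_column (h : ℕ) : IsDraw 2 1 h := by
  intro p
  let I : Position 1 → Prop := fun P =>
    (∀ x y q, P.Occupies q x y → (q = .one ↔ Even y)) ∧
      (P.turn = .one ↔ Even (P.columns 0).length)
  refine exists_ensures I _ ⟨fun _ _ _ h => (not_occupies_initial h).elim, by simp [initial]⟩
    ?_ ?_ ?_
  rotate_left
  · rintro P c ⟨ho, ht⟩ - - -
    obtain rfl : c = 0 := Subsingleton.elim _ _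
    constructor
    · intro x y q hq
      rcases (occupies_play _).1 hq with hq | ⟨rfl, rfl, rfl⟩
      · exact ho x y q hq
      · exact_mod_cast ht
    · simp only [turn_play, play_columns_self, List.length_append, List.length_singleton,
        Nat.even_add_one, ← ht]
      cases P.turn <;> simp [Player.opponent]
  · rintro P ⟨ho, -⟩ - hc
    obtain ⟨x, y, x', y', ha, hb, hne, hx, hy⟩ := connected_two_iff.1 hc
    have hx0 := ha.mem_range
    have hx1 := hb.mem_range
    rw [abs_le] at hy
    have := (ho _ _ _ ha).symm.trans (ho _ _ _ hb)
    rcases (show y' = y + 1 ∨ y = y' + 1 by omega) with rfl | rfl <;>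
    · simp only [Int.even_add_one] at this
      tauto
  · rintro P ⟨ho, ht⟩ hO -
    have hl : ∃ c, P.Legal h c := by
      by_contra hc
      push Not at hc
      exact hO (Or.inr hc)
    obtain ⟨c, hc⟩ := hl
    refine ⟨c, hc, ?_⟩
    obtain rfl : c = 0 := Subsingleton.elim _ _
    constructor
    · intro x y q hq
      rcases (occupies_play _).1 hq with hq | ⟨rfl, rfl, rfl⟩
      · exact ho x y q hq
      · exact_mod_cast ht
    · simp only [turn_play, play_columns_self, List.length_append, List.length_singleton,
        Nat.even_add_one, ← ht]
      cases P.turn <;> simp [Player.opponent]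

/-! ### Player one on narrow boards of height one -/

/-- Player `q` owns two neighbouring columns of a board of height one. -/
def Neighbours {w : ℕ} (P : Position w) (q : Player) : Prop :=
  ∃ i j : Fin w, (i : ℕ) + 1 = j ∧ P.columns i = [q] ∧ P.columns j = [q]

instance {w : ℕ} (P : Position w) (q : Player) : Decidable (Neighbours P q) :=
  inferInstanceAs (Decidable (∃ i j : Fin w, (i : ℕ) + 1 = j ∧ P.columns i = [q] ∧
    P.columns j = [q]))

/-- Player one can avoid losing for `n` more moves on a board of height one. -/
def Holds {w : ℕ} : ℕ → Position w → Prop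
  | 0, P => ¬ Neighbours P .one ∧ ∀ c, P.columns c ≠ []
  | n + 1, P => ¬ Neighbours P .one ∧ (Neighbours P .two ∨
      (P.turn = .one ∧ ∃ c, P.columns c = [] ∧ Holds n (P.play c)) ∨
      (P.turn = .two ∧ ∀ c, P.columns c = [] → Holds n (P.play c)))

instance decidableHolds {w : ℕ} : ∀ (n : ℕ) (P : Position w), Decidable (Holds n P)
  | 0, P => inferInstanceAs (Decidable (¬ Neighbours P .one ∧ ∀ c, P.columns c ≠ []))
  | n + 1, P => by
    have := fun c => decidableHolds n (P.play c)
    unfold Holds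
    infer_instance

theorem neighbours_iff {w : ℕ} {P : Position w} (hP : ∀ c, (P.columns c).length ≤ 1)
    {q : Player} : Neighbours P q ↔ P.Connected 2 q := by
  have key : ∀ c, P.columns c = [q] ↔ P.Occupies q ((c : ℕ) : ℤ) 0 := by
    intro c
    rw [occupies_zero]
    have := hP c
    rcases hc : P.columns c with _ | ⟨a, _ | ⟨b, l⟩⟩ <;> simp_all
  have row : ∀ {x y}, P.Occupies q x y → y = 0 := by
    rintro x y ⟨c, r, rfl, rfl, h⟩
    have := hP c
    have := (List.getElem?_eq_some_iff.1 h).1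
    omega
  rw [connected_two_iff]
  constructor
  · rintro ⟨i, j, hij, hi, hj⟩
    exact ⟨_, _, _, _, (key i).1 hi, (key j).1 hj, by omega, by rw [abs_le]; omega, by simp⟩
  · rintro ⟨x, y, x', y', ha, hb, hne, hx, hy⟩
    obtain rfl := row ha
    obtain rfl := row hb
    rw [abs_le] at hx
    obtain ⟨i, -, rfl, -⟩ := id ha
    obtain ⟨j, -, rfl, -⟩ := id hb
    rcases (show (i : ℕ) + 1 = j ∨ (j : ℕ) + 1 = i by omega) with h | h
    · exact ⟨i, j, h, (key i).2 ha, (key j).2 hb⟩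
    · exact ⟨j, i, h, (key j).2 hb, (key i).2 ha⟩

theorem exists_ensures_one_of_holds {w n : ℕ} [NeZero w] (h : Holds n (initial w)) :
    ∃ s : Strategy w, Ensures 2 1 .one s fun P => ¬ P.Connected 2 .one := by
  have len : ∀ (P : Position w) c, (∀ c, (P.columns c).length ≤ 1) → P.columns c = [] →
      ∀ d, ((P.play c).columns d).length ≤ 1 := by
    intro P c hP hc d
    by_cases hd : d = c
    · subst hd; simp [hc]
    · rw [play_columns_of_ne _ hd]; exact hP d
  have holds_one : ∀ {n} {P : Position w}, Holds n P → ¬ Neighbours P .one := by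
    rintro (_ | n) P hn
    · exact hn.1
    · exact hn.1
  refine exists_ensures (fun P => (∀ c, (P.columns c).length ≤ 1) ∧ ∃ n, Holds n P) _
    ⟨by simp [initial], n, h⟩ ?_ ?_ ?_
  · rintro P ⟨hP, n, hn⟩ hO ht
    have hO' : ∃ c, P.Legal 1 c := by
      by_contra hc
      push Not at hc
      exact hO (Or.inr hc)
    obtain ⟨c, hc⟩ := hO'
    have hc : P.columns c = [] := by simpa [Legal] using hc
    rcases n with _ | n
    · exact (hn.2 c hc).elim
    · obtain ⟨-, h2 | ⟨-, d, hd, hn⟩ | ⟨h, -⟩⟩ := hn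
      · exact (hO (Or.inl ⟨_, (neighbours_iff hP).1 h2⟩)).elim
      · exact ⟨d, by simp [Legal, hd], len P d hP hd, n, hn⟩
      · simp [ht] at h
  · rintro P c ⟨hP, n, hn⟩ hO ht hc
    have hc : P.columns c = [] := by simpa [Legal] using hc
    rcases n with _ | n
    · exact (hn.2 c hc).elim
    · obtain ⟨-, h2 | ⟨h, -⟩ | ⟨-, hn⟩⟩ := hn
      · exact (hO (Or.inl ⟨_, (neighbours_iff hP).1 h2⟩)).elim
      · exact (ht h).elim
      · exact ⟨len P c hP hc, n, hn c hc⟩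
  · rintro P ⟨hP, n, hn⟩ -
    rw [← neighbours_iff hP]
    exact holds_one hn

/-- The bound is the number of cells, so the search reaches full rows. -/
theorem holds_initial_two : Holds 2 (initial 2) := by decide

theorem holds_initial_four : Holds 4 (initial 4) := by decide

theorem holds_initial_six : Holds 6 (initial 6) := by decide

/-! ### Boards of odd height -/

section OddHeight

variable {w h : ℕ} (Row : (ℤ → Prop) → (ℤ → Prop) → Prop)

/-- The positions that player two maintains on a board of odd height: the bottom row satisfies
`Row`, and only the columns at the ends are higher than one. -/
structure RowInvariant (h : ℕ) (P : Position w) : Prop where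
  turn : P.turn = .one
  row : Row (fun x => P.Occupies .one x 0) (fun x => P.Occupies .two x 0)
  not_connected : ¬ P.Connected 2 .two
  length_le : ∀ c, (P.columns c).length ≤ h
  high : ∀ c, (P.columns c).length ≤ 1 ∨ Odd (P.columns c).length ∧ 3 ≤ w ∧
    ((c : ℕ) = 0 ∨ (c : ℕ) + 1 = w)
  even_row : ∀ x y, P.Occupies .two x y → Even y
  even_pieces : Even P.pieces

variable {Row}

theorem rowInvariant_initial (start : Row (fun _ => False) (fun _ => False)) :
    RowInvariant Row h (initial w) where
  turn := rfl
  row := by simpa [not_occupies_initial] using start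
  not_connected := not_connected_initial
  length_le := by simp [initial]
  high := by simp [initial]
  even_row _ _ h := (not_occupies_initial h).elim
  even_pieces := by simp [pieces, initial]

theorem RowInvariant.not_connected_play {P : Position w} (hP : RowInvariant Row h P) (c : Fin w) :
    ¬ (P.play c).Connected 2 .two := fun hc => by
  have := (hc.of_play hP.not_connected).1
  simp [hP.turn] at this

/-- A safe move into an empty column is `Playable` in the bottom row, so `step` supplies the reply.
-/
theorem RowInvariant.reply_bottom {P : Position w} (hP : RowInvariant Row h P) (hh : 1 ≤ h)
    (step : ∀ O T c, Row O T → (∀ x, T x → 0 ≤ x ∧ x < (w : ℤ)) → (∀ x, O x → ¬ T x) →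
      Playable w O T c → ∃ r, Reply w O T c Row r)
    {c : Fin w} (hc : P.columns c = []) (h1 : ¬ (P.play c).Connected 2 .one) :
    ∃ d, (P.play c).Legal h d ∧ RowInvariant Row h ((P.play c).play d) := by
  have vacant : ∀ (d : Fin w) q, P.columns d = [] → ¬ P.Occupies q ((d : ℕ) : ℤ) 0 := by
    intro d q hd
    simp [occupies_zero, hd]
  have adj : ∀ x : ℤ, |x - ((c : ℕ) : ℤ)| ≤ 1 → ¬ P.Occupies .one x 0 := fun x hx ho =>
    h1 (hP.turn ▸ connected_play_of_occupies c (hP.turn.symm ▸ ho) hx (by simp [hc]))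
  obtain ⟨r, ⟨hr0, hrw, hrO, hrT⟩, hrc, hrl, hrr, hrow⟩ := step _ _ ((c : ℕ) : ℤ) hP.row
    (fun x hx => ⟨hx.mem_range.1, hx.mem_range.2.1⟩)
    (fun x hx hx' => by simpa using hx.unique hx')
    ⟨⟨by omega, by have := c.isLt; omega, vacant c _ hc, vacant c _ hc⟩,
      adj _ (by simp), adj _ (by simp)⟩
  obtain ⟨r, rfl⟩ := Int.eq_ofNat_of_zero_le hr0
  obtain ⟨d, rfl⟩ : ∃ d : Fin w, (d : ℕ) = r := ⟨⟨r, by omega⟩, rfl⟩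
  have hdc : d ≠ c := fun h => hrc (by rw [h])
  have hd : P.columns d = [] := by
    by_contra hd
    obtain ⟨q, hq⟩ := exists_occupies d (List.length_pos_iff.2 hd)
    cases q
    · exact hrO hq
    · exact hrT hq
  set Q := P.play c with hQ
  have hQt : Q.turn = .two := by simp [hQ, hP.turn, Player.opponent]
  have hQd : Q.columns d = [] := by rw [hQ, play_columns_of_ne _ hdc, hd]
  have occ1 : ∀ x y, (Q.play d).Occupies .one x y ↔
      P.Occupies .one x y ∨ x = ((c : ℕ) : ℤ) ∧ y = 0 := by
    intro x y
    rw [occupies_play, hQt, hQ, occupies_play, hP.turn, hc]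
    simp
  have occQ : ∀ x y, Q.Occupies .two x y ↔ P.Occupies .two x y := by
    intro x y
    rw [hQ, occupies_play, hP.turn]
    simp
  have occ2 : ∀ x y, (Q.play d).Occupies .two x y ↔
      P.Occupies .two x y ∨ x = ((d : ℕ) : ℤ) ∧ y = 0 := by
    intro x y
    rw [occupies_play, hQt, hQd, occQ]
    simp
  have col : ∀ e, (Q.play d).columns e = P.columns e ∨ ((Q.play d).columns e).length = 1 := by
    intro e
    by_cases hed : e = d
    · right; rw [hed, play_columns_self, hQd]; rfl
    rw [play_columns_of_ne _ hed]
    by_cases hec : e = c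
    · right; rw [hec, hQ, play_columns_self, hc]; rfl
    · left; rw [hQ, play_columns_of_ne _ hec]
  refine ⟨d, by simp [Legal, hQd]; omega, ?_, ?_, ?_, fun e => ?_, fun e => ?_, fun x y hxy => ?_,
    ?_⟩
  · simp [hQt, Player.opponent]
  · simpa [occ1, occ2] using hrow
  · intro hcon
    obtain ⟨-, x, y, ho, hx, hy⟩ := hcon.of_play (hP.not_connected_play c)
    rw [occQ] at ho
    obtain ⟨m, hm⟩ := hP.even_row x y ho
    rw [hQd, abs_le] at hy
    rw [abs_le] at hx
    simp only [List.length_nil, Nat.cast_zero] at hy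
    -- Player two has no piece in row `1`, so only the bottom row can be involved.
    obtain rfl : y = 0 := by omega
    rcases (show x = d ∨ x = (d : ℤ) - 1 ∨ x = (d : ℤ) + 1 by omega) with rfl | rfl | rfl
    · exact hrT ho
    · exact hrl ho
    · exact hrr ho
  · rcases col e with he | he
    · rw [he]; exact hP.length_le e
    · rwa [he]
  · rcases col e with he | he
    · rw [he]; exact hP.high e
    · exact Or.inl he.le
  · rcases (occ2 x y).1 hxy with h | ⟨-, rfl⟩
    · exact hP.even_row x y h
    · exact Even.zero
  · rw [pieces_play, hQ, pieces_play, add_assoc]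
    exact hP.even_pieces.add even_two

/-- A safe climb is possible only in an end column of odd length, and player two answers on top of
it. As `h` is odd, there is room. -/
theorem RowInvariant.reply_top {P : Position w} (hP : RowInvariant Row h P) (ho : Odd h)
    (supported : 1 < h → ∀ O T, Row O T → Supported w O T)
    {c : Fin w} (hc : P.columns c ≠ []) (hl : P.Legal h c)
    (h1 : ¬ (P.play c).Connected 2 .one) :
    ∃ d, (P.play c).Legal h d ∧ RowInvariant Row h ((P.play c).play d) := by
  have adj : ∀ x y : ℤ, |x - ((c : ℕ) : ℤ)| ≤ 1 → |y - (P.columns c).length| ≤ 1 →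
      ¬ P.Occupies .one x y := fun x y hx hy ho =>
    h1 (hP.turn ▸ connected_play_of_occupies c (hP.turn.symm ▸ ho) hx hy)
  have hpos : 0 < (P.columns c).length := List.length_pos_iff.2 hc
  obtain ⟨⟨m, hm⟩, hw, hend⟩ : Odd (P.columns c).length ∧ 3 ≤ w ∧
      ((c : ℕ) = 0 ∨ (c : ℕ) + 1 = w) := by
    rcases hP.high c with h | h
    · have hlen : (P.columns c).length = 1 := by omega
      obtain ⟨q, hq⟩ := exists_occupies c hpos
      cases q
      · exact (adj _ _ (by simp) (by simp [hlen]) hq).elim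
      · simp only [Legal] at hl
        rcases supported (by omega) _ _ hP.row _ hq with h | h | h
        · exact (adj _ _ (by simp) (by simp [hlen]) h).elim
        · exact (adj _ _ (by simp) (by simp [hlen]) h).elim
        · exact ⟨hlen ▸ odd_one, by omega, by omega⟩
    · exact h
  set Q := P.play c with hQ
  have hQt : Q.turn = .two := by simp [hQ, hP.turn, Player.opponent]
  have hQlen : (Q.columns c).length = (P.columns c).length + 1 := by simp [hQ]
  have occ1 : ∀ x, (Q.play c).Occupies .one x 0 ↔ P.Occupies .one x 0 := by
    intro x
    rw [occupies_play, hQt, hQ, occupies_play, hP.turn]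
    simp only [reduceCtorEq, false_and, or_false, true_and, or_iff_left_iff_imp]
    omega
  have occQ : ∀ x y, Q.Occupies .two x y ↔ P.Occupies .two x y := by
    intro x y
    rw [hQ, occupies_play, hP.turn]
    simp
  have occ2 : ∀ x y, (Q.play c).Occupies .two x y ↔
      P.Occupies .two x y ∨ x = ((c : ℕ) : ℤ) ∧ y = (P.columns c).length + 1 := by
    intro x y
    rw [occupies_play, hQt, hQlen, occQ]
    simp
  have occ2' : ∀ x, (Q.play c).Occupies .two x 0 ↔ P.Occupies .two x 0 := by
    intro x
    rw [occ2]
    constructor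
    · rintro (h | ⟨-, h⟩)
      · exact h
      · omega
    · exact Or.inl
  have hlegal : (P.columns c).length + 1 < h := by
    obtain ⟨n, hn⟩ := ho
    simp only [Legal] at hl
    omega
  have col : ∀ e, e ≠ c → (Q.play c).columns e = P.columns e := by
    intro e he
    rw [play_columns_of_ne _ he, hQ, play_columns_of_ne _ he]
  have colc : ((Q.play c).columns c).length = (P.columns c).length + 2 := by
    rw [play_columns_self, List.length_append, hQlen]
    rfl
  refine ⟨c, by rwa [Legal, hQlen], ?_, ?_, ?_, fun e => ?_, fun e => ?_, fun x y hxy => ?_, ?_⟩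
  · simp [hQt, Player.opponent]
  · simpa [occ1, occ2'] using hP.row
  · intro hcon
    obtain ⟨-, x, y, ho, hx, hy⟩ := hcon.of_play (hP.not_connected_play c)
    rw [occQ] at ho
    obtain ⟨n, hn⟩ := hP.even_row x y ho
    rw [hQlen, abs_le] at hy
    rw [abs_le] at hx
    obtain ⟨e, r, rfl, rfl, hr⟩ := ho
    have hr := (List.getElem?_eq_some_iff.1 hr).1
    have hec : e ≠ c := by rintro rfl; omega
    have hec' : (e : ℕ) ≠ c := fun h => hec (Fin.ext h)
    -- A neighbouring piece of player two would lie in an even row above the bottom, hence in the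
    -- other end column; but the ends are not adjacent as `3 ≤ w`.
    rcases hP.high e with h | ⟨-, -, h⟩ <;> omega
  · by_cases he : e = c
    · rw [he, colc]; omega
    · rw [col e he]; exact hP.length_le e
  · by_cases he : e = c
    · rw [he, colc]; exact Or.inr ⟨⟨m + 1, by omega⟩, hw, hend⟩
    · rw [col e he]; exact hP.high e
  · rcases (occ2 x y).1 hxy with h | ⟨-, rfl⟩
    · exact hP.even_row x y h
    · exact ⟨m + 1, by omega⟩
  · rw [pieces_play, hQ, pieces_play, add_assoc]
    exact hP.even_pieces.add even_two

/-- A strategy for the bottom row extends to a board of odd height. -/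
theorem exists_ensures_of_row (hw : 1 ≤ w) (ho : Odd h)
    (start : Row (fun _ => False) (fun _ => False))
    (step : ∀ O T c, Row O T → (∀ x, T x → 0 ≤ x ∧ x < (w : ℤ)) → (∀ x, O x → ¬ T x) →
      Playable w O T c → ∃ r, Reply w O T c Row r)
    (supported : 1 < h → ∀ O T, Row O T → Supported w O T) :
    ∃ s : Strategy w, Ensures 2 h .two s fun P =>
      ¬ P.Connected 2 .two ∧ (RowInvariant Row h P ∨ P.Connected 2 .one) := by
  have : NeZero w := ⟨by omega⟩
  refine exists_ensures_two _ (rowInvariant_initial start) (fun P hP => hP.turn)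
    (fun P hP => hP.not_connected) (fun P c hP => hP.not_connected_play c) fun P c hP hl h1 => ?_
  by_cases hc : P.columns c = []
  · exact hP.reply_bottom ho.pos step hc h1
  · exact hP.reply_top ho supported hc hl h1

end OddHeight

/-! ### Outcomes on boards of odd height -/

theorem exists_ensures_safeRow {w h : ℕ} (hw : 2 ≤ w) (ho : Odd h) :
    ∃ s : Strategy w, Ensures 2 h .two s fun P =>
      ¬ P.Connected 2 .two ∧ (RowInvariant (SafeRow w) h P ∨ P.Connected 2 .one) :=
  exists_ensures_of_row (by omega) ho (safeRow_empty (by omega))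
    (fun _ _ _ hR hT hOT hc => hR.reply hT hOT hc) fun _ _ _ hR => hR.2

/-- Player two wins if he can maintain an invariant that excludes full boards. -/
theorem winFor_two_of_row {w h : ℕ} {Row : (ℤ → Prop) → (ℤ → Prop) → Prop}
    (hs : ∃ s : Strategy w, Ensures 2 h .two s fun P =>
      ¬ P.Connected 2 .two ∧ (RowInvariant Row h P ∨ P.Connected 2 .one))
    (hfull : ∀ P : Position w, RowInvariant Row h P → ¬ P.Connected 2 .one →
      ∃ c, P.Legal h c) : WinFor 2 w h .two := by
  obtain ⟨s, hs⟩ := hs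
  refine ⟨s, hs.mono ?_⟩
  rintro P hO ⟨h2, hP | h1⟩
  · by_contra h1
    obtain ⟨c, hc⟩ := hfull P hP h1
    rcases hO with ⟨q, hq⟩ | hO
    · cases q
      · exact h1 hq
      · exact h2 hq
    · exact hO c hc
  · exact h1

theorem winFor_two_of_odd_height {w h : ℕ} (hw : 2 ≤ w) (hh : 1 < h) (ho : Odd h) :
    WinFor 2 w h .two := by
  refine winFor_two_of_row (exists_ensures_safeRow hw ho) fun P hP h1 => ?_
  by_contra! hfull
  obtain ⟨q, hq⟩ := exists_connected_of_full (P := P) hw hh hfull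
  cases q
  · exact h1 hq
  · exact hP.not_connected hq

theorem winFor_two_of_odd_width {w : ℕ} (hw : 2 ≤ w) (ho : Odd w) : WinFor 2 w 1 .two := by
  refine winFor_two_of_row (exists_ensures_safeRow hw odd_one) fun P hP h1 => ?_
  by_contra! hfull
  have hlen : ∀ c, (P.columns c).length = 1 := fun c =>
    le_antisymm (hP.length_le c) (not_lt.1 (hfull c))
  -- With player one to move, the number of pieces is even, whereas a full row would hold `w` of
  -- them.
  have := hP.even_pieces
  simp only [pieces, hlen, Finset.sum_const, Finset.card_univ, Fintype.card_fin, smul_eq_mul,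
    mul_one] at this
  exact Nat.not_even_iff_odd.2 ho this

/-- A row that is filled without a connection alternates, so its players do not clash. -/
theorem not_clashing_of_full {w : ℕ} {P : Position w} (h1 : ¬ P.Connected 2 .one)
    (h2 : ¬ P.Connected 2 .two)
    (full : ∀ x : ℕ, x < w → P.Occupies .one x 0 ∨ P.Occupies .two x 0) :
    ¬ Clashing (fun x => P.Occupies .one x 0) (fun x => P.Occupies .two x 0) := by
  have disj : ∀ x : ℤ, P.Occupies .one x 0 → ¬ P.Occupies .two x 0 := fun x h h' => by
    simpa using h.unique h'
  have adj : ∀ q (x : ℕ), ¬ P.Connected 2 q → P.Occupies q x 0 →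
      ¬ P.Occupies q ((x + 1 : ℕ) : ℤ) 0 := fun q x hq h h' =>
    hq (connected_two_iff.2 ⟨_, _, _, _, h, h', by simp, by simp, by simp⟩)
  have alt : ∀ x : ℕ, x < w → (P.Occupies .one x 0 ↔ (Even x ↔ P.Occupies .one 0 0)) := by
    intro x
    induction x with
    | zero => simp
    | succ x ih =>
      intro hx
      have ih := ih (by omega)
      have a1 := adj .one x h1
      have a2 := adj .two x h2
      have f := full x (by omega)
      have f' := full (x + 1) hx
      rw [Nat.even_add_one]
      tauto
  rintro ⟨x, y, hx, hy, hxy⟩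
  have rx := hx.mem_range
  have ry := hy.mem_range
  obtain ⟨x, rfl⟩ := Int.eq_ofNat_of_zero_le rx.1
  obtain ⟨y, rfl⟩ := Int.eq_ofNat_of_zero_le ry.1
  have ax := alt x (by omega)
  have ay := alt y (by omega)
  rw [Int.even_sub, Int.even_coe_nat, Int.even_coe_nat] at hxy
  have := disj y
  tauto

theorem winFor_two_of_even_width {w : ℕ} (hw : 8 ≤ w) (he : Even w) : WinFor 2 w 1 .two := by
  have hs := exists_ensures_of_row (w := w) (h := 1) (Row := WinningRow w) (by omega) odd_one
    (Or.inl (by simp)) (fun _ _ _ hR hT hOT hc => hR.reply (by omega) (by exact_mod_cast he)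
      hT hOT hc) (fun h => absurd h (lt_irrefl 1))
  refine winFor_two_of_row hs fun P hP h1 => ?_
  by_contra! hfull
  have full : ∀ x : ℕ, x < w → P.Occupies .one x 0 ∨ P.Occupies .two x 0 := by
    intro x hx
    obtain ⟨q, hq⟩ := exists_occupies (P := P) ⟨x, hx⟩ (r := 0) (not_lt.1 (hfull ⟨x, hx⟩))
    cases q
    · exact Or.inl hq
    · exact Or.inr hq
  -- The three alternatives of `WinningRow` without a clash all leave cell `1` vacant.
  have := full 1 (by omega)
  rcases hP.row with h | h | h | ⟨h, -⟩
  · simp only [h, or_self] at this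
  · simp only [h] at this
    omega
  · simp only [h] at this
    omega
  · exact not_clashing_of_full h1 hP.not_connected full h

theorem isDraw_of_holds {w n : ℕ} (hw : 2 ≤ w) (h : Holds n (initial w)) : IsDraw 2 w 1 := by
  have : NeZero w := ⟨by omega⟩
  rintro (_ | _)
  · exact exists_ensures_one_of_holds h
  · obtain ⟨s, hs⟩ := exists_ensures_safeRow hw odd_one
    exact ⟨s, hs.mono fun P _ hP => hP.1⟩

end MisereConnect

theorem mainTheorem6 (w h : ℕ) (hw : 1 ≤ w) (hh : 1 ≤ h) :
    (h = 1 →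
      (w ∈ ({1, 2, 4, 6} : Set ℕ) → MisereConnect.IsDraw 2 w h) ∧
      (w ∉ ({1, 2, 4, 6} : Set ℕ) → MisereConnect.WinFor 2 w h MisereConnect.Player.two)) ∧
    (1 < h →
      (w = 1 → MisereConnect.IsDraw 2 w h) ∧
      (1 < w → MisereConnect.WinFor 2 w h MisereConnect.Player.two)) := by
  open MisereConnect in
  refine ⟨?_, fun h1 => ⟨?_, fun w1 => ?_⟩⟩
  · rintro rfl
    simp only [Set.mem_insert_iff, Set.mem_singleton_iff]
    constructor
    · rintro (rfl | rfl | rfl | rfl)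
      · exact isDraw_one_column 1
      · exact isDraw_of_holds le_rfl holds_initial_two
      · exact isDraw_of_holds (by norm_num) holds_initial_four
      · exact isDraw_of_holds (by norm_num) holds_initial_six
    · intro hw'
      rcases Nat.even_or_odd w with he | ho
      · refine winFor_two_of_even_width ?_ he
        obtain ⟨m, rfl⟩ := he
        omega
      · exact winFor_two_of_odd_width (by omega) ho
  · rintro rfl
    exact isDraw_one_column h
  · rcases Nat.even_or_odd h with he | ho
    · exact winFor_two_of_even_height w1 hh he
    · exact winFor_two_of_odd_height w1 h1 ho
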